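/- Let $k$ be an even positive integer, $s$ a positive integer, $A$ a finite abelian group of odd order and exponent $M$, and let $\mathbb{F}_{2^k}$ be the field with $2^k$ elements. For a finite abelian group $G$ (written additively), an abelian code in a group ring $R[G]$ is an ideal of $R[G]$; a cyclic code of length $n$ over $R$ is an ideal of $R[\mathbb{Z}_n]$. On $\mathbb{F}_{q^2}[G]$ the Hermitian inner product is $\langle \sum_g\alpha_gY^g,\sum_g\beta_gY^g\rangle_{\mathrm H}=\sum_g\alpha_g\rho(\beta_g)$ with $\rho(a)=a^q$, and on $(\mathbb{F}_{q^2}+u\mathbb{F}_{q^2})[G]$, where $u^2=0$, it is given by the same formula with $\rho(a+ub)=a^q+ub^q$. A code $C$ is Hermitian self-dual if $C=C^{\perp_{\mathrm H}}:=\{x : \langle x,c\rangle_{\mathrm H}=0 \text{ for all } c\in C\}$. Let $N(2^m,n)$ be the number of cyclic codes of length $n$ over $\mathbb{F}_{2^m}+u\mathbb{F}_{2^m}$ and, for even $m$, let $NH(2^m,n)$ be the number of those that are Hermitian self-dual. For $d$ odd, let $\mathrm{ord}_d(2^k)$ be the multiplicative order of $2^k$ modulo $d$, let $\mathcal{N}_A(d)$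 be the number of elements of order $d$ in $A$, and let $\lambda(d,2^{k/2})=0$ if $d$ divides $2^{(k/2)t}+1$ for some odd integer $t\ge 1$, and $\lambda(d,2^{k/2})=1$ otherwise. Then the number of Hermitian self-dual abelian codes in $\mathbb{F}_{2^k}[A\times\mathbb{Z}_2\times\mathbb{Z}_{2^s}]$ is $$\prod_{d\mid M}\bigl(NH(2^{k\cdot\mathrm{ord}_d(2^k)},2^s)\bigr)^{(1-\lambda(d,2^{k/2}))\frac{\mathcal{N}_A(d)}{\mathrm{ord}_d(2^k)}}\times\prod_{d\mid M}\bigl(N(2^{k\cdot\mathrm{ord}_d(2^k)},2^s)\bigr)^{\lambda(d,2^{k/2})\frac{\mathcal{N}_A(d)}{2\,\mathrm{ord}_d(2^k)}},$$ where all the exponents are non-negative integers. -/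

import Mathlib

open scoped BigOperators

noncomputable section

namespace AbelianCode

/-- The `ρ`-inner product `∑ g, α_g * ρ (β_g)` of two elements of the group ring `R[G]`. -/
def innerRho {R G : Type*} [CommRing R] [Fintype G] (ρ : R → R)
    (u v : AddMonoidAlgebra R G) : R :=
  ∑ g : G, u.coeff g * ρ (v.coeff g)

/-- The dual of a subset `C` of `R[G]` with respect to the `ρ`-inner product. -/
def dualRho {R G : Type*} [CommRing R] [Fintype G] (ρ : R → R)
    (C : Set (AddMonoidAlgebra R G)) : Set (AddMonoidAlgebra R G) :=
  {u | ∀ v ∈ C, innerRho ρ u v = 0}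

/-- The abelian codes (ideals of `R[G]`) that are equal to their `ρ`-dual. -/
def selfDualCodes {R G : Type*} [CommRing R] [AddCommGroup G] [Fintype G] (ρ : R → R) :
    Set (Ideal (AddMonoidAlgebra R G)) :=
  {C | (C : Set (AddMonoidAlgebra R G)) = dualRho ρ (C : Set (AddMonoidAlgebra R G))}

/-- The map `a ↦ a ^ q` of a field (used for a field with `q ^ 2` elements). -/
def fieldConj {K : Type*} [Field K] (q : ℕ) (a : K) : K := a ^ q

/-- The map `a + u b ↦ a ^ q + u b ^ q` of the ring `K + u K`, `u ^ 2 = 0`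
(used for a field `K` with `q ^ 2` elements). -/
def dualNumberConj {K : Type*} [Field K] (q : ℕ) (x : DualNumber K) : DualNumber K :=
  TrivSqZeroExt.inl (x.fst ^ q) + TrivSqZeroExt.inr (x.snd ^ q)

/-- `N(p ^ m, n)`: the number of cyclic codes of length `n` over `F + u F`, where `F` is the field
with `p ^ m` elements (`0 < m`) and `u ^ 2 = 0`. -/
def numCyclic (p m n : ℕ) [Fact p.Prime] : ℕ :=
  Nat.card (Ideal (AddMonoidAlgebra (DualNumber (GaloisField p m)) (ZMod n)))

/-- `NH(p ^ m, n)`: the number of Hermitian self-dual cyclic codes of length `n` over `F + u F`,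
where `F` is the field with `p ^ m` elements (`0 < m`, `m` even) and `u ^ 2 = 0`. -/
def numHermitianCyclic (p m n : ℕ) [Fact p.Prime] [NeZero n] : ℕ :=
  Nat.card (selfDualCodes (G := ZMod n)
    (dualNumberConj (K := GaloisField p m) (p ^ (m / 2))))

/-- `ord_d(a)`: the multiplicative order of `a` modulo `d`. -/
def ordMod (d a : ℕ) : ℕ := orderOf (a : ZMod d)

/-- The number of elements of order `d` in `A`. -/
def numOfOrder (A : Type*) [AddCommGroup A] (d : ℕ) : ℕ :=
  Nat.card {a : A // addOrderOf a = d}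

/-- The pair `(j, q)` is oddly good if `j` divides `q ^ t + 1` for some odd `t ≥ 1`. -/
def OddlyGood (j q : ℕ) : Prop := ∃ t : ℕ, Odd t ∧ j ∣ q ^ t + 1

open Classical in
/-- The indicator that is `0` if `(j, q)` is oddly good and `1` otherwise. -/
def lam (j q : ℕ) : ℕ := if OddlyGood j q then 0 else 1

end AbelianCode

end

/-!
Let `q = 2 ^ (k / 2)` and `H = ℤ/2 × ℤ/2ˢ`. The Hermitian form on a group ring sends `(x, y)` to the
constant coefficient of `x * σ y`, where `σ` is the semilinear involution that inverts the group
elements. As ideals are stable under translation, an ideal `C` is Hermitian self-dual if and only if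
it is the annihilator of `σ(C)` (`selfDualCodes_eq`). This condition only mentions the ring and its
involution, so the codes can be counted after any ring isomorphism that respects the involutions.

The group ring of `A × H` over `F` is the group ring of `H` over `B = F[A]`. As `A` has odd order,
every element of `B` is fixed by a power of Frobenius. Hence `B` is reduced, and it is the product
of its residue fields `B/m`. The involution of `B` permutes the maximal ideals `m`. A fixed `m`
contributes the self-dual ideals of `(B/m)[H]`. A pair of conjugate ideals contributes all ideals of
`(B/m)[H]`, because an ideal of a group algebra over a field is the annihilator of its annihilator
(`mem_of_forall_annihilator`), so that one member of the pair can be chosen freely and determines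
the other (`card_selfDualIdeals_groupRing`). In characteristic two, `K[ℤ/2] = K + uK` with `u = 1 + Y`,
which turns both contributions into counts of cyclic codes over `K + uK`.

It remains to sort the maximal ideals `m` by the order `d` of the character `A → (B/m)ˣ`.
* The field `B/m` is generated by the `d`-th roots of unity and has degree `r = ord_d(2 ^ k)` over
  `F` (`finrank_eq_ordMod`).
* Each `m` is the kernel of `r` homomorphisms into an algebraic closure of `F`, and these
  homomorphisms are the characters of `A`; therefore there are `N_A(d) / r` ideals `m` for each `d`
  (`card_maximal_mul_ordMod`).
* The ideal `m` is fixed by the involution if and only if `d` divides `q ^ t + 1` for some odd `t`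
  (`maximalComap_eq_self_iff`), and in this case the involution induces the square-root Frobenius of
  `B/m` (`map_conjHom_of_oddlyGood`).
-/

open scoped BigOperators

namespace AbelianCode

open AddMonoidAlgebra

/-! ### The conjugation of a group ring -/

/-- The ring homomorphism `∑ r_g Y^g ↦ ∑ f(r_g) Y^{-g}` between group rings induced by a ring
homomorphism `f` of the coefficients. -/
noncomputable def conjHom {R S : Type*} [CommRing R] [CommRing S] (G : Type*) [AddCommGroup G]
    (f : R →+* S) : AddMonoidAlgebra R G →+* AddMonoidAlgebra S G :=
  (mapDomainRingHom S (-AddMonoidHom.id G)).comp (mapRingHom G f)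

section conjHom

variable {R S T G : Type*} [CommRing R] [CommRing S] [CommRing T] [AddCommGroup G]

@[simp]
lemma conjHom_single (f : R →+* S) (g : G) (r : R) :
    conjHom G f (single g r) = single (-g) (f r) := by
  simp [conjHom]

lemma coeff_conjHom (f : R →+* S) (x : AddMonoidAlgebra R G) (g : G) :
    (conjHom G f x).coeff g = f (x.coeff (-g)) := by
  classical
  induction x using AddMonoidAlgebra.induction_linear with
  | zero => simp
  | add x y hx hy => simp [hx, hy]
  | single a r =>
    rw [conjHom_single, coeff_single, coeff_single, Finsupp.single_apply, Finsupp.single_apply,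
      apply_ite f, map_zero]
    simp only [neg_eq_iff_eq_neg]

lemma conjHom_conjHom (f : R →+* S) (g : S →+* T) (x : AddMonoidAlgebra R G) :
    conjHom G g (conjHom G f x) = mapRingHom G (g.comp f) x := by
  induction x using AddMonoidAlgebra.induction_linear with
  | zero => simp
  | add x y hx hy => simp [hx, hy]
  | single a r => simp

end conjHom

/-! ### Self-dual codes as ideals equal to an annihilator -/

/-- The annihilator of the image of the ideal `C` under a ring homomorphism `φ`. -/
def dualIdeal {S T : Type*} [CommRing S] [CommRing T] (φ : S →+* T) (C : Ideal S) : Ideal T where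
  carrier := {x | ∀ c ∈ C, x * φ c = 0}
  add_mem' hx hy c hc := by rw [add_mul, hx c hc, hy c hc, add_zero]
  zero_mem' c _ := zero_mul _
  smul_mem' a x hx c hc := by rw [smul_eq_mul, mul_assoc, hx c hc, mul_zero]

lemma mem_dualIdeal {S T : Type*} [CommRing S] [CommRing T] {φ : S →+* T} {C : Ideal S} {x : T} :
    x ∈ dualIdeal φ C ↔ ∀ c ∈ C, x * φ c = 0 := Iff.rfl

/-- The ideals `C` that equal the annihilator of `σ(C)`. -/
def selfDualIdeals {R : Type*} [CommRing R] (σ : R →+* R) : Set (Ideal R) :=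
  {C | C = dualIdeal σ C}

section selfDual

variable {R G : Type*} [CommRing R] [AddCommGroup G] [Fintype G]

/-- The inner product is the constant coefficient of the product with the conjugate. -/
lemma coeff_mul_conjHom (ρ : R →+* R) (x y : AddMonoidAlgebra R G) :
    (x * conjHom G ρ y).coeff 0 = innerRho ρ x y := by
  rw [coeff_mul_apply_left, Finsupp.sum_fintype _ _ (by simp), innerRho]
  simp [coeff_conjHom]

/-- For an ideal, orthogonality with respect to the inner product is the same as annihilation of
the conjugate, because an ideal is stable under translation by group elements. -/
lemma coe_dualIdeal_conjHom (ρ : R →+* R) (C : Ideal (AddMonoidAlgebra R G)) :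
    (dualIdeal (conjHom G ρ) C : Set (AddMonoidAlgebra R G)) = dualRho ρ C := by
  ext x
  simp only [SetLike.mem_coe, mem_dualIdeal, dualRho, Set.mem_ofPred_eq, ← coeff_mul_conjHom]
  refine ⟨fun h c hc ↦ by simp [h c hc], fun h c hc ↦ ?_⟩
  ext g
  have := h (single g 1 * c) (C.mul_mem_left _ hc)
  rw [map_mul, conjHom_single, map_one, mul_left_comm, coeff_single_mul_apply] at this
  simpa using this

lemma selfDualCodes_eq (ρ : R →+* R) :
    selfDualCodes (G := G) ρ = selfDualIdeals (conjHom G ρ) := by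
  ext C
  rw [selfDualCodes, selfDualIdeals, Set.mem_ofPred_eq, Set.mem_ofPred_eq, ← coe_dualIdeal_conjHom,
    SetLike.coe_set_eq]

end selfDual

lemma card_selfDualIdeals_congr {R S : Type*} [CommRing R] [CommRing S] (e : R ≃+* S)
    {σ : R →+* R} {σ' : S →+* S} (h : ∀ x, e (σ x) = σ' (e x)) :
    Nat.card (selfDualIdeals σ) = Nat.card (selfDualIdeals σ') := by
  refine Nat.card_congr (Equiv.subtypeEquiv e.symm.idealComapOrderIso.toEquiv fun C ↦ ?_)
  change C = _ ↔ C.comap e.symm = dualIdeal σ' (C.comap e.symm)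
  have key : dualIdeal σ' (C.comap e.symm) = (dualIdeal σ C).comap e.symm := by
    ext x
    simp only [mem_dualIdeal, Ideal.mem_comap]
    refine ⟨fun H c hc ↦ e.injective ?_, fun H c hc ↦ e.symm.injective ?_⟩
    · simpa [h] using H (e c) (by simpa using hc)
    · have := H _ hc
      rw [← e.symm_apply_apply (σ (e.symm c)), h] at this
      simpa using this
  rw [key]
  exact (e.symm.idealComapOrderIso.injective.eq_iff (a := C)).symm

/-! ### Group rings of products and the ring `K + uK` -/

/-- `R[G × H]` as a group ring of `H` over the ring `R[G]`. -/
noncomputable def curryRight (R G H : Type*) [CommRing R] [AddCommGroup G] [AddCommGroup H] :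
    AddMonoidAlgebra R (G × H) ≃+* AddMonoidAlgebra (AddMonoidAlgebra R G) H :=
  (curryRingEquiv (R := R) (M := G) (N := H)).trans (commAlgEquiv R).toRingEquiv

lemma curryRight_conjHom {R G H : Type*} [CommRing R] [AddCommGroup G] [AddCommGroup H]
    (f : R →+* R) (x : AddMonoidAlgebra R (G × H)) :
    curryRight R G H (conjHom _ f x) = conjHom H (conjHom G f) (curryRight R G H x) := by
  induction x using AddMonoidAlgebra.induction_linear with
  | zero => simp
  | add x y hx hy => simp [hx, hy]
  | single a r => obtain ⟨g, h⟩ := a; simp [curryRight]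

/-- The ring homomorphism `a + u b ↦ f a + u f b` induced by `f`. -/
def dualNumberMap {K L : Type*} [CommRing K] [CommRing L] (f : K →+* L) :
    DualNumber K →+* DualNumber L where
  toFun x := TrivSqZeroExt.inl (f x.fst) + TrivSqZeroExt.inr (f x.snd)
  map_one' := by ext <;> simp
  map_mul' x y := by ext <;> simp [mul_comm]
  map_zero' := by ext <;> simp
  map_add' x y := by ext <;> simp

/-- In characteristic two, `K + u K` is the group ring of the group of order two, `u` being
`1 + Y`: this is the ring homomorphism `a + u b ↦ (a + b) + b Y`. -/
noncomputable def dualNumberToGroupRing (K : Type*) [CommRing K] [CharP K 2] :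
    DualNumber K →+* AddMonoidAlgebra K (ZMod 2) where
  toFun x := single 0 (x.fst + x.snd) + single 1 x.snd
  map_one' := by simp [one_def]
  map_mul' x y := by
    have h2 : (2 : K) = 0 := CharTwo.two_eq_zero
    -- The coefficients on the two sides differ by `2 * x.snd * y.snd`.
    have key (a b c d : K) : (single (0 : ZMod 2) a + single 1 b) * (single 0 c + single 1 d) =
        single 0 (a * c + b * d) + single 1 (a * d + b * c) := by
      rw [mul_add, add_mul, add_mul, single_mul_single, single_mul_single, single_mul_single,
        single_mul_single, (by decide : (1 : ZMod 2) + 1 = 0), add_zero, zero_add, add_zero,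
        single_add, single_add]
      abel
    rw [key]
    congr 2 <;> simp only [TrivSqZeroExt.fst_mul, TrivSqZeroExt.snd_mul, smul_eq_mul,
      MulOpposite.smul_eq_mul_unop, MulOpposite.unop_op]
    · linear_combination (-x.snd * y.snd) * h2
    · linear_combination (-x.snd * y.snd) * h2
  map_zero' := by simp
  map_add' x y := by
    simp only [TrivSqZeroExt.fst_add, TrivSqZeroExt.snd_add, single_add]; abel

lemma dualNumberToGroupRing_apply {K : Type*} [CommRing K] [CharP K 2] (x : DualNumber K) :
    dualNumberToGroupRing K x = single 0 (x.fst + x.snd) + single 1 x.snd := rfl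

lemma dualNumberToGroupRing_bijective (K : Type*) [CommRing K] [CharP K 2] :
    Function.Bijective (dualNumberToGroupRing K) := by
  have h0 (x : DualNumber K) : (dualNumberToGroupRing K x).coeff 0 = x.fst + x.snd := by
    simp [dualNumberToGroupRing_apply]
  have h1 (x : DualNumber K) : (dualNumberToGroupRing K x).coeff 1 = x.snd := by
    simp [dualNumberToGroupRing_apply]
  refine ⟨fun x y h ↦ ?_, fun x ↦ ⟨.inl (x.coeff 0 - x.coeff 1) + .inr (x.coeff 1), ?_⟩⟩
  · have e1 : x.snd = y.snd := by rw [← h1, h, h1]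
    have e0 : x.fst + x.snd = y.fst + y.snd := by rw [← h0, h, h0]
    ext
    · simpa [e1] using e0
    · exact e1
  · ext i
    fin_cases i
    · exact (h0 _).trans (by simp; rfl)
    · exact (h1 _).trans (by simp; rfl)

lemma dualNumberToGroupRing_map {K L : Type*} [CommRing K] [CharP K 2] [CommRing L] [CharP L 2]
    (f : K →+* L) (x : DualNumber K) :
    dualNumberToGroupRing L (dualNumberMap f x) =
      conjHom (ZMod 2) f (dualNumberToGroupRing K x) := by
  have h : (-1 : ZMod 2) = 1 := by decide
  simp [dualNumberToGroupRing_apply, dualNumberMap, h]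

/-- Conjugations along `f` and `f'` are intertwined by changes of coefficients that intertwine `f`
and `f'`. -/
lemma mapRingHom_conjHom {R S R' S' G : Type*} [CommRing R] [CommRing S] [CommRing R']
    [CommRing S'] [AddCommGroup G] (f : R →+* S) (f' : R' →+* S') (e : R →+* R') (e' : S →+* S')
    (h : ∀ r, e' (f r) = f' (e r)) (x : AddMonoidAlgebra R G) :
    mapRingHom G e' (conjHom G f x) = conjHom G f' (mapRingHom G e x) := by
  induction x using AddMonoidAlgebra.induction_linear with
  | zero => simp
  | add x y hx hy => simp [hx, hy]
  | single a r => simp [h]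

lemma mapRingHom_bijective {R S : Type*} (G : Type*) [CommRing R] [CommRing S] [AddCommGroup G]
    {f : R →+* S} (hf : Function.Bijective f) : Function.Bijective (mapRingHom G f) :=
  ⟨AddMonoidAlgebra.map_injective (f : R →+ S) hf.1,
    AddMonoidAlgebra.map_surjective (f : R →+ S) hf.2⟩

/-- The group ring over `K + u K` of `H` is the group ring over `K` of `ℤ/2 × H`. -/
noncomputable def dualNumberGroupRingEquiv (K H : Type*) [CommRing K] [CharP K 2]
    [AddCommGroup H] :
    AddMonoidAlgebra (DualNumber K) H ≃+* AddMonoidAlgebra K (ZMod 2 × H) :=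
  (RingEquiv.ofBijective _ (mapRingHom_bijective H (dualNumberToGroupRing_bijective K))).trans
    (curryRight K (ZMod 2) H).symm

lemma dualNumberGroupRingEquiv_conjHom {K H : Type*} [CommRing K] [CharP K 2]
    [AddCommGroup H] (f : K →+* K) (x : AddMonoidAlgebra (DualNumber K) H) :
    dualNumberGroupRingEquiv K H (conjHom H (dualNumberMap f) x) =
      conjHom _ f (dualNumberGroupRingEquiv K H x) := by
  apply (curryRight K (ZMod 2) H).injective
  rw [curryRight_conjHom]
  simp only [dualNumberGroupRingEquiv, RingEquiv.trans_apply, RingEquiv.apply_symm_apply,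
    RingEquiv.ofBijective_apply]
  exact mapRingHom_conjHom _ _ _ _ (dualNumberToGroupRing_map f) x

lemma card_ideal_groupRing_congr {R S : Type*} (G : Type*) [CommRing R] [CommRing S]
    [AddCommGroup G] (e : R ≃+* S) :
    Nat.card (Ideal (AddMonoidAlgebra R G)) = Nat.card (Ideal (AddMonoidAlgebra S G)) :=
  Nat.card_congr (RingEquiv.ofBijective _
    (mapRingHom_bijective G (f := (e : R →+* S)) e.bijective)).idealComapOrderIso.symm.toEquiv

lemma card_selfDual_groupRing_congr {R S : Type*} (G : Type*) [CommRing R] [CommRing S]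
    [AddCommGroup G] (e : R ≃+* S) {ρ : R →+* R} {ρ' : S →+* S} (h : ∀ r, e (ρ r) = ρ' (e r)) :
    Nat.card (selfDualIdeals (conjHom G ρ)) = Nat.card (selfDualIdeals (conjHom G ρ')) :=
  card_selfDualIdeals_congr (RingEquiv.ofBijective _
    (mapRingHom_bijective G (f := (e : R →+* S)) e.bijective))
    fun x ↦ mapRingHom_conjHom ρ ρ' (e : R →+* S) (e : R →+* S) h x

/-! ### Cyclic codes over `K + uK` as ideals over `K` -/

lemma nonempty_ringEquiv_galoisField {m : ℕ} (hm : m ≠ 0) {K : Type*} [Field K]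
    (hK : Nat.card K = 2 ^ m) : Nonempty (K ≃+* GaloisField 2 m) := by
  have : Finite K := Nat.finite_of_card_ne_zero (by simp [hK])
  have := Fintype.ofFinite K
  have := Fintype.ofFinite (GaloisField 2 m)
  exact ⟨FiniteField.ringEquivOfCardEq
    (by rw [← Nat.card_eq_fintype_card, ← Nat.card_eq_fintype_card, hK, GaloisField.card 2 m hm])⟩

/-- For `m ≠ 0` every field with `2 ^ m` elements can replace the Galois field in `numCyclic`. -/
lemma numCyclic_eq {m : ℕ} (hm : m ≠ 0) {K : Type*} [Field K] (hK : Nat.card K = 2 ^ m) (n : ℕ) :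
    Nat.card (Ideal (AddMonoidAlgebra K (ZMod 2 × ZMod n))) = numCyclic 2 m n := by
  obtain ⟨e⟩ := nonempty_ringEquiv_galoisField hm hK
  rw [card_ideal_groupRing_congr _ e, numCyclic]
  exact Nat.card_congr (dualNumberGroupRingEquiv _ _).symm.idealComapOrderIso.symm.toEquiv

/-- For `m ≠ 0` the count `numHermitianCyclic` can be computed over every field `K` with `2 ^ m`
elements, in the group algebra of `ℤ/2 × ℤ/n` with the square-root Frobenius of `K`. -/
lemma numHermitianCyclic_eq {m : ℕ} (hm : m ≠ 0) {K : Type*} [Field K] (hK : Nat.card K = 2 ^ m)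
    (n : ℕ) [NeZero n] {σ : K →+* K} (hσ : ∀ x, σ x = x ^ 2 ^ (m / 2)) :
    Nat.card (selfDualIdeals (conjHom (ZMod 2 × ZMod n) σ)) = numHermitianCyclic 2 m n := by
  obtain ⟨e⟩ := nonempty_ringEquiv_galoisField hm hK
  have hconj : dualNumberConj (K := GaloisField 2 m) (2 ^ (m / 2)) =
      dualNumberMap (iterateFrobenius (GaloisField 2 m) 2 (m / 2)) := by
    funext x
    simp [dualNumberConj, dualNumberMap, iterateFrobenius_def]
  rw [card_selfDual_groupRing_congr _ e (ρ' := iterateFrobenius (GaloisField 2 m) 2 (m / 2))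
      fun r ↦ by rw [hσ, map_pow, iterateFrobenius_def],
    numHermitianCyclic, hconj, selfDualCodes_eq]
  exact (card_selfDualIdeals_congr (dualNumberGroupRingEquiv _ _)
    (dualNumberGroupRingEquiv_conjHom _)).symm

/-! ### Self-dual ideals of a product with permuted factors -/

/-- If an endomorphism `σ` of a finite product permutes the factors, then an ideal is self-dual
if and only if its component at `i` is dual to its component at `τ i`. -/
lemma card_selfDualIdeals_pi {ι R : Type*} [Finite ι] [CommRing R] {S : ι → Type*}
    [∀ i, CommRing (S i)] (e : R ≃+* ∀ i, S i) (σ : R →+* R) (τ : ι → ι)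
    (σ' : ∀ i j, τ i = j → S j →+* S i)
    (h : ∀ x i, e (σ x) i = σ' i (τ i) rfl (e x (τ i))) :
    Nat.card (selfDualIdeals σ) =
      Nat.card {f : ∀ i, Ideal (S i) // ∀ i j hij, f i = dualIdeal (σ' i j hij) (f j)} := by
  classical
  let E : (∀ i, Ideal (S i)) ≃o Ideal R :=
    Ideal.piOrderIso.symm.trans e.idealComapOrderIso
  have hE (f : ∀ i, Ideal (S i)) (x : R) : x ∈ E f ↔ ∀ i, e x i ∈ f i := Iff.rfl
  refine (Nat.card_congr (Equiv.subtypeEquiv E.toEquiv fun f ↦ ?_)).symm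
  have key : dualIdeal σ (E f) = E fun i ↦ dualIdeal (σ' i (τ i) rfl) (f (τ i)) := by
    ext x
    simp only [mem_dualIdeal, hE]
    refine ⟨fun H i c hc ↦ ?_, fun H c hc ↦ e.injective (funext fun i ↦ ?_)⟩
    · have := H (e.symm (Pi.single (τ i) c)) fun j ↦ by
        rw [e.apply_symm_apply]
        obtain rfl | hj := eq_or_ne j (τ i)
        · simpa using hc
        · simp [hj]
      simpa [h] using congrFun (congrArg e this) i
    · simpa [h] using H i _ (hc (τ i))
  change _ ↔ E f = dualIdeal σ (E f)
  rw [key, E.injective.eq_iff, funext_iff]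
  exact forall_congr' fun i ↦ ⟨fun H ↦ H _ rfl, by rintro H _ rfl; exact H⟩

/-- Families that are compatible with mutually inverse maps along an involution `τ` of the index
set are determined by their members at the fixed points, and at one point of every two-element
orbit. -/
lemma card_compatible_families {ι : Type*} [Fintype ι] [LinearOrder ι] {X : ι → Type*}
    {τ : ι → ι} (hτ : ∀ i, τ (τ i) = i) (D : ∀ i j, τ i = j → X j → X i)
    (hD : ∀ i j (hij : τ i = j) (hji : τ j = i) (x : X i), D i j hij (D j i hji x) = x)
    (a b : ι → ℕ) (ha : ∀ i (hi : τ i = i), Nat.card {x // x = D i i hi x} = a i)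
    (hb : ∀ i, τ i ≠ i → Nat.card (X i) = b i) :
    Nat.card {f : ∀ i, X i // ∀ i j hij, f i = D i j hij (f j)} =
      (∏ i with τ i = i, a i) * ∏ i with i < τ i, b i := by
  have hbij : Function.Bijective
      (fun f : {f : ∀ i, X i // ∀ i j hij, f i = D i j hij (f j)} ↦
        ((fun i ↦ ⟨f.1 i, f.2 i i i.2⟩ : ∀ i : {i // τ i = i}, {x // x = D i i i.2 x}),
          (fun i ↦ f.1 i : ∀ i : {i // i < τ i}, X i))) := by
    constructor
    · rintro ⟨f, hf⟩ ⟨g, hg⟩ hfg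
      obtain ⟨h1, h2⟩ := Prod.ext_iff.1 hfg
      refine Subtype.ext (funext fun i ↦ ?_)
      change f i = g i
      rcases lt_trichotomy i (τ i) with hi | hi | hi
      · exact congrFun h2 ⟨i, hi⟩
      · exact congrArg Subtype.val (congrFun h1 ⟨i, hi.symm⟩)
      · rw [hf i _ rfl, hg i _ rfl]
        exact congrArg _ (congrFun h2 ⟨τ i, by rwa [hτ]⟩)
    · rintro ⟨x, y⟩
      let f (i : ι) : X i :=
        if h : τ i = i then (x ⟨i, h⟩).1
        else if h' : i < τ i then y ⟨i, h'⟩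
        else D i (τ i) rfl (y ⟨τ i, by rw [hτ]; exact lt_of_le_of_ne (not_lt.1 h') h⟩)
      have f_fix (i) (h : τ i = i) : f i = (x ⟨i, h⟩).1 := dif_pos h
      have f_lt (i) (h : i < τ i) : f i = y ⟨i, h⟩ := by
        simp only [f, dif_neg h.ne', dif_pos h]
      have f_gt (i j) (hij : τ i = j) (h : j < i) : f i = D i j hij (f j) := by
        subst hij
        rw [f_lt (τ i) (by rwa [hτ])]
        simp only [f, dif_neg h.ne, dif_neg h.not_gt]
      refine ⟨⟨f, fun i j hij ↦ ?_⟩, Prod.ext (funext fun i ↦ Subtype.ext (f_fix i i.2))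
        (funext fun i ↦ f_lt i i.2)⟩
      rcases lt_trichotomy i j with h | rfl | h
      · have hji : τ j = i := by rw [← hij, hτ]
        rw [f_gt j i hji h, hD]
      · rw [f_fix i hij]
        exact (x ⟨i, hij⟩).2
      · exact f_gt i j hij h
  rw [Nat.card_congr (Equiv.ofBijective _ hbij), Nat.card_prod, Nat.card_pi, Nat.card_pi]
  rw [Finset.prod_subtype _ (p := fun i ↦ τ i = i) (by simp),
    Finset.prod_subtype _ (p := fun i ↦ i < τ i) (by simp)]
  exact congrArg₂ _ (Finset.prod_congr rfl fun i _ ↦ ha i i.2)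
    (Finset.prod_congr rfl fun i _ ↦ hb i i.2.ne')

/-! ### Duality in group algebras over fields -/

/-- An ideal of a group algebra of a finite group over a field is the annihilator of its
annihilator: the pairing of `x` and `y` into the constant coefficient of `x * y` is
nondegenerate. -/
lemma mem_of_forall_annihilator {K H : Type*} [Field K] [AddCommGroup H] [Finite H]
    (C : Ideal (AddMonoidAlgebra K H)) {x : AddMonoidAlgebra K H}
    (hx : ∀ z, (∀ c ∈ C, z * c = 0) → x * z = 0) : x ∈ C := by
  let b : LinearMap.BilinForm K (AddMonoidAlgebra K H) :=
    LinearMap.mk₂ K (fun x y ↦ (x * y).coeff 0) (by simp [add_mul]) (by simp)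
      (by simp [mul_add]) (by simp)
  have hb (x y) : b x y = (x * y).coeff 0 := rfl
  have hsymm (x y) : b x y = b y x := by rw [hb, hb, mul_comm]
  have hsep (x) (h : ∀ y, b x y = 0) : x = 0 := by
    ext g
    simpa [hb, coeff_mul_single_apply] using h (single (-g) 1)
  have hnd : b.Nondegenerate :=
    ⟨hsep, fun y h ↦ hsep y fun x ↦ by rw [hsymm, h]⟩
  have hrefl : b.IsRefl := fun x y h ↦ by rw [hsymm, h]
  have : FiniteDimensional K (AddMonoidAlgebra K H) := inferInstance
  have key := LinearMap.BilinForm.orthogonal_orthogonal hnd hrefl (C.restrictScalars K)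
  have hmem : x ∈ C.restrictScalars K := by
    rw [← key, LinearMap.BilinForm.mem_orthogonal_iff]
    intro z hz
    rw [LinearMap.BilinForm.mem_orthogonal_iff] at hz
    change b z x = 0
    rw [hsymm, hb, hx z, coeff_zero, Finsupp.zero_apply]
    intro c hc
    ext g
    have := hz (single (-g) 1 * c) (C.mul_mem_left _ hc)
    change b _ _ = 0 at this
    rw [hb, mul_assoc, coeff_single_mul_apply] at this
    rw [mul_comm]
    simpa using this
  exact hmem

/-- Taking duals along mutually inverse isomorphisms of the coefficient fields is an inverse pair of
maps on ideals. -/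
lemma dualIdeal_dualIdeal {K L H : Type*} [Field K] [Field L] [AddCommGroup H] [Finite H]
    {f : K →+* L} {g : L →+* K} (hfg : ∀ x, f (g x) = x) (hgf : ∀ x, g (f x) = x)
    (C : Ideal (AddMonoidAlgebra K H)) :
    dualIdeal (conjHom H g) (dualIdeal (conjHom H f) C) = C := by
  have hg (x) : conjHom H g (conjHom H f x) = x := by
    rw [conjHom_conjHom, (RingHom.ext hgf : g.comp f = RingHom.id K)]
    ext; simp [mapRingHom]
  have hf (x) : conjHom H f (conjHom H g x) = x := by
    rw [conjHom_conjHom, (RingHom.ext hfg : f.comp g = RingHom.id L)]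
    ext; simp [mapRingHom]
  refine le_antisymm (fun x hx ↦ mem_of_forall_annihilator C fun z hz ↦ ?_) fun x hx y hy ↦ ?_
  · have := hx (conjHom H f z) fun c hc ↦ by rw [← map_mul, hz c hc, map_zero]
    rwa [hg] at this
  · have := congrArg (conjHom H g) (hy x hx)
    rwa [map_mul, hg, map_zero, mul_comm] at this

/-- A group ring of a finite group over a product of rings is the product of the group rings. -/
noncomputable def groupRingPiEquiv {B ι H : Type*} [CommRing B] [Finite H] [AddCommGroup H]
    {S : ι → Type*} [∀ i, CommRing (S i)] (e : B ≃+* ∀ i, S i) :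
    AddMonoidAlgebra B H ≃+* ∀ i, AddMonoidAlgebra (S i) H :=
  RingEquiv.ofBijective
    (RingHom.pi fun i ↦ mapRingHom H ((Pi.evalRingHom S i).comp (e : B →+* ∀ i, S i))) <| by
    constructor
    · intro x y hxy
      ext h
      refine e.injective (funext fun i ↦ ?_)
      exact congrArg (fun z ↦ z.coeff h) (congrFun hxy i)
    · intro y
      refine ⟨ofCoeff (Finsupp.equivFunOnFinite.symm
        fun h ↦ e.symm fun i ↦ (y i).coeff h), funext fun i ↦ ?_⟩
      ext h
      change e (e.symm fun i ↦ (y i).coeff h) i = _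
      rw [e.apply_symm_apply]

lemma groupRingPiEquiv_conjHom {B ι H : Type*} [CommRing B] [Finite H] [AddCommGroup H]
    {S : ι → Type*} [∀ i, CommRing (S i)] (e : B ≃+* ∀ i, S i) {σ : B →+* B} {i j : ι}
    {f : S j →+* S i} (h : ∀ b, e (σ b) i = f (e b j)) (x : AddMonoidAlgebra B H) :
    groupRingPiEquiv e (conjHom H σ x) i = conjHom H f (groupRingPiEquiv e x j) :=
  mapRingHom_conjHom σ f ((Pi.evalRingHom S j).comp (e : B →+* ∀ i, S i))
    ((Pi.evalRingHom S i).comp (e : B →+* ∀ i, S i)) h x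

/-! ### The characters behind homomorphisms from a group ring -/

/-- The order of the character `a ↦ φ(Y^a)` of `A` attached to a ring homomorphism `φ` from a
group ring of `A`. The order is taken in the monoid `A → K` of functions under pointwise
multiplication, which avoids units. -/
noncomputable def charOrder {R A K : Type*} [CommRing R] [AddCommGroup A] [CommRing K]
    (φ : AddMonoidAlgebra R A →+* K) : ℕ :=
  orderOf fun a : A ↦ φ (single a 1)

section charOrder

variable {R A K : Type*} [CommRing R] [AddCommGroup A] [CommRing K]

lemma charOrder_dvd_iff {φ : AddMonoidAlgebra R A →+* K} {n : ℕ} :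
    charOrder φ ∣ n ↔ ∀ a, φ (single a 1) ^ n = 1 := by
  rw [charOrder, orderOf_dvd_iff_pow_eq_one, funext_iff]
  rfl

lemma pow_charOrder (φ : AddMonoidAlgebra R A →+* K) (a : A) :
    φ (single a 1) ^ charOrder φ = 1 := charOrder_dvd_iff.1 dvd_rfl a

lemma charOrder_dvd_exponent (φ : AddMonoidAlgebra R A →+* K) :
    charOrder φ ∣ AddMonoid.exponent A :=
  charOrder_dvd_iff.2 fun a ↦ by
    rw [← map_pow, single_pow, AddMonoid.exponent_nsmul_eq_zero, one_pow, ← one_def, map_one]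

lemma charOrder_eq_of_forall {L R' : Type*} [CommRing L] [CommRing R']
    {φ : AddMonoidAlgebra R A →+* K} {ψ : AddMonoidAlgebra R' A →+* L}
    (h : ∀ n : ℕ, (∀ a, φ (single a 1) ^ n = 1) ↔ ∀ a, ψ (single a 1) ^ n = 1) :
    charOrder φ = charOrder ψ :=
  Nat.dvd_antisymm (charOrder_dvd_iff.2 ((h _).2 (pow_charOrder ψ)))
    (charOrder_dvd_iff.2 ((h _).1 (pow_charOrder φ)))

lemma mul_map_single_neg (φ : AddMonoidAlgebra R A →+* K) (a : A) :
    φ (single a 1) * φ (single (-a) 1) = 1 := by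
  rw [← map_mul, single_mul_single, add_neg_cancel, one_mul, ← one_def, map_one]

/-- In characteristic two, whether a power of Frobenius carries one homomorphism to another can be
checked on the coefficients and on the group elements. -/
lemma pow_eq_of_forall_single [CharP K 2] (φ ψ : AddMonoidAlgebra R A →+* K) {n : ℕ}
    (h0 : ∀ r, φ (single 0 r) ^ 2 ^ n = ψ (single 0 r))
    (h1 : ∀ a, φ (single a 1) ^ 2 ^ n = ψ (single a 1)) (x : AddMonoidAlgebra R A) :
    φ x ^ 2 ^ n = ψ x := by
  have : (iterateFrobenius K 2 n).comp φ = ψ :=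
    AddMonoidAlgebra.ringHom_ext (fun r ↦ by simpa [iterateFrobenius_def] using h0 r)
      (fun a ↦ by simpa [iterateFrobenius_def] using h1 a)
  rw [← this]
  rfl

end charOrder

section finite

variable {F A K : Type*} [Field F] [AddCommGroup A] [CommRing K] {k : ℕ}

lemma pow_two_pow_mul (hF : Nat.card F = 2 ^ k) (a : F) (n : ℕ) :
    a ^ 2 ^ (k * n) = a := by
  have : Finite F := Nat.finite_of_card_ne_zero (by simp [hF])
  have := Fintype.ofFinite F
  rw [pow_mul, ← hF, Nat.card_eq_fintype_card, FiniteField.pow_card_pow]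

lemma pow_two_pow_half_mul (hF : Nat.card F = 2 ^ k) (hk : Even k) (a : F) {t : ℕ} (ht : Odd t) :
    a ^ 2 ^ (k / 2 * t) = a ^ 2 ^ (k / 2) := by
  obtain ⟨j, rfl⟩ := ht
  have : k / 2 * (2 * j + 1) = k * j + k / 2 := by
    nth_rw 2 [← Nat.div_two_mul_two_of_even hk]
    ring
  rw [this, pow_add, pow_mul, pow_two_pow_mul hF]

/-- The values of `φ` satisfy the equation `z ^ 2 ^ (k * r) = z` of the field with `2 ^ (k * r)`
elements, `r` being the order of `2 ^ k` modulo the order of the character. -/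
lemma map_pow_ordMod [CharP K 2] (hF : Nat.card F = 2 ^ k) (φ : AddMonoidAlgebra F A →+* K)
    (x : AddMonoidAlgebra F A) :
    φ x ^ 2 ^ (k * ordMod (charOrder φ) (2 ^ k)) = φ x := by
  refine pow_eq_of_forall_single φ φ (fun r ↦ ?_) (fun a ↦ ?_) x
  · rw [← map_pow, single_pow, nsmul_zero, pow_two_pow_mul hF]
  · have h : 2 ^ (k * ordMod (charOrder φ) (2 ^ k)) ≡ 1 [MOD charOrder φ] := by
      rw [← ZMod.natCast_eq_natCast_iff, pow_mul, Nat.cast_pow, ordMod, pow_orderOf_eq_one,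
        Nat.cast_one]
    rw [pow_eq_pow_of_modEq h (pow_charOrder φ a), pow_one]

/-- If `2 ^ (k / 2 * t) ≡ -1` modulo the order of the character, with `t` odd, then the conjugation
of the group ring is induced by the Frobenius power `z ↦ z ^ 2 ^ (k / 2 * t)`. -/
lemma map_conjHom_eq_pow [CharP F 2] [CharP K 2] (hF : Nat.card F = 2 ^ k) (hk : Even k)
    (φ : AddMonoidAlgebra F A →+* K) {t : ℕ} (ht : Odd t)
    (hd : charOrder φ ∣ (2 ^ (k / 2)) ^ t + 1) (x : AddMonoidAlgebra F A) :
    φ (conjHom A (iterateFrobenius F 2 (k / 2)) x) = φ x ^ 2 ^ (k / 2 * t) := by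
  symm
  refine pow_eq_of_forall_single φ (φ.comp (conjHom A (iterateFrobenius F 2 (k / 2))))
    (fun r ↦ ?_) (fun a ↦ ?_) x
  · rw [← map_pow, single_pow, nsmul_zero, pow_two_pow_half_mul hF hk _ ht, RingHom.comp_apply,
      conjHom_single, neg_zero, iterateFrobenius_def]
  · have h1 : φ (single a 1) * φ (single a 1) ^ 2 ^ (k / 2 * t) = 1 := by
      rw [← pow_succ', pow_mul]
      exact charOrder_dvd_iff.1 hd a
    have h2 := mul_map_single_neg φ a
    rw [RingHom.comp_apply, conjHom_single, map_one]
    calc _ = φ (single a 1) ^ 2 ^ (k / 2 * t) * (φ (single a 1) * φ (single (-a) 1)) := by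
          rw [h2, mul_one]
      _ = (φ (single a 1) * φ (single a 1) ^ 2 ^ (k / 2 * t)) * φ (single (-a) 1) := by ring
      _ = _ := by rw [h1, one_mul]

lemma conjHom_iterateFrobenius_involutive [CharP F 2] (hF : Nat.card F = 2 ^ k) (hk : Even k)
    (x : AddMonoidAlgebra F A) :
    conjHom A (iterateFrobenius F 2 (k / 2)) (conjHom A (iterateFrobenius F 2 (k / 2)) x) = x := by
  have : (iterateFrobenius F 2 (k / 2)).comp (iterateFrobenius F 2 (k / 2)) = RingHom.id F :=
    RingHom.ext fun a ↦ by
      rw [RingHom.comp_apply, iterateFrobenius_def, iterateFrobenius_def, ← pow_mul, ← pow_add,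
        ← mul_two, Nat.div_two_mul_two_of_even hk]
      simpa using pow_two_pow_mul hF a 1
  rw [conjHom_conjHom, this]
  ext; simp [mapRingHom]

end finite

/-! ### Residue fields of the group algebra of `A` -/

section residue

variable {F A K : Type*} [Field F] [AddCommGroup A] [Finite A] [Field K] [Algebra F K] {k : ℕ}

omit [Finite A] in
lemma charOrder_odd {R K : Type*} [CommRing R] [CommRing K] (hA : Odd (Nat.card A))
    (φ : AddMonoidAlgebra R A →+* K) : Odd (charOrder φ) :=
  hA.of_dvd_nat ((charOrder_dvd_exponent φ).trans AddGroup.exponent_dvd_nat_card)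

omit [Finite A] in
lemma charOrder_eq_of_ker_eq {R K L : Type*} [CommRing R] [CommRing K] [CommRing L]
    {φ : AddMonoidAlgebra R A →+* K} {ψ : AddMonoidAlgebra R A →+* L}
    (h : RingHom.ker φ = RingHom.ker ψ) : charOrder φ = charOrder ψ := by
  refine charOrder_eq_of_forall fun n ↦ forall_congr' fun a ↦ ?_
  rw [← map_pow, ← map_pow, ← sub_eq_zero, ← map_one φ, ← map_sub, ← RingHom.mem_ker, h,
    RingHom.mem_ker, map_sub, map_one, sub_eq_zero]

lemma finite_of_surjective (hF : Nat.card F = 2 ^ k) {φ : AddMonoidAlgebra F A →ₐ[F] K}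
    (hφ : Function.Surjective φ) : Finite K := by
  have : Finite F := Nat.finite_of_card_ne_zero (by simp [hF])
  have : Finite (AddMonoidAlgebra F A) := Module.finite_of_finite F
  exact Finite.of_surjective _ hφ

lemma ordMod_pos {d a : ℕ} (hd : 0 < d) (h : a.Coprime d) : 0 < ordMod d a := by
  have : NeZero d := ⟨hd.ne'⟩
  have hu : ((ZMod.unitOfCoprime a h : (ZMod d)ˣ) : ZMod d) = a := ZMod.coe_unitOfCoprime a h
  rw [ordMod, ← hu, orderOf_units]
  exact orderOf_pos _

lemma ordMod_dvd_iff {d a n : ℕ} (ha : 0 < a) : ordMod d a ∣ n ↔ d ∣ a ^ n - 1 := by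
  rw [ordMod, orderOf_dvd_iff_pow_eq_one, ← Nat.cast_pow, ← Nat.cast_one,
    eq_comm, ZMod.natCast_eq_natCast_iff, Nat.modEq_iff_dvd' (Nat.one_le_pow _ _ ha)]

lemma frobeniusAlgHom_pow_apply {F K : Type*} [Field F] [Fintype F] [Field K] [Algebra F K] (n : ℕ)
    (y : K) : (FiniteField.frobeniusAlgHom F K ^ n) y = y ^ Nat.card F ^ n := by
  rw [AlgHom.coe_pow, FiniteField.coe_frobeniusAlgHom, pow_iterate, Nat.card_eq_fintype_card]

/-- The degree of the field generated by the values of a character of order `d` over the field with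
`2 ^ k` elements is the order of `2 ^ k` modulo `d`. -/
lemma finrank_eq_ordMod (hF : Nat.card F = 2 ^ k) {φ : AddMonoidAlgebra F A →ₐ[F] K}
    (hφ : Function.Surjective φ) :
    Module.finrank F K = ordMod (charOrder (φ : AddMonoidAlgebra F A →+* K)) (2 ^ k) := by
  have : Finite F := Nat.finite_of_card_ne_zero (by simp [hF])
  have := Fintype.ofFinite F
  have : Finite K := finite_of_surjective hF hφ
  have := Fintype.ofFinite K
  have : CharP F 2 := charP_of_card_eq_prime_pow (Nat.card_eq_fintype_card.symm.trans hF)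
  have : CharP K 2 := charP_of_injective_algebraMap (algebraMap F K).injective 2
  have hcard : Fintype.card K = (2 ^ k) ^ Module.finrank F K := by
    rw [← hF, ← Nat.card_eq_fintype_card, Module.natCard_eq_pow_finrank (K := F)]
  refine Nat.dvd_antisymm ?_ ?_
  · rw [← FiniteField.orderOf_frobeniusAlgHom F K]
    refine orderOf_dvd_of_pow_eq_one (AlgHom.ext fun y ↦ ?_)
    obtain ⟨x, rfl⟩ := hφ y
    rw [frobeniusAlgHom_pow_apply, hF, ← pow_mul]
    exact map_pow_ordMod hF (φ : AddMonoidAlgebra F A →+* K) x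
  · rw [ordMod_dvd_iff (by positivity), charOrder_dvd_iff, ← hcard]
    intro a
    exact FiniteField.pow_card_sub_one_eq_one _
      (left_ne_zero_of_mul_eq_one (mul_map_single_neg _ a))

lemma natCard_eq_of_surjective (hF : Nat.card F = 2 ^ k) {φ : AddMonoidAlgebra F A →ₐ[F] K}
    (hφ : Function.Surjective φ) :
    Nat.card K = 2 ^ (k * ordMod (charOrder (φ : AddMonoidAlgebra F A →+* K)) (2 ^ k)) := by
  have : Finite F := Nat.finite_of_card_ne_zero (by simp [hF])
  have : Finite K := finite_of_surjective hF hφ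
  rw [← finrank_eq_ordMod hF hφ, Module.natCard_eq_pow_finrank (K := F), hF, pow_mul]

/-- If the conjugation of the group ring descends to the residue field, then the order of the
character is oddly good: up to a power of Frobenius, the descended map is `F`-linear, so it is
itself a power of Frobenius. -/
lemma oddlyGood_of_conj [CharP F 2] (hF : Nat.card F = 2 ^ k) (hk2 : Even k)
    (hA : Odd (Nat.card A))
    {φ : AddMonoidAlgebra F A →ₐ[F] K} (hφ : Function.Surjective φ) {σ : K →+* K}
    (hσ : ∀ x, σ (φ x) = φ (conjHom A (iterateFrobenius F 2 (k / 2)) x)) :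
    OddlyGood (charOrder (φ : AddMonoidAlgebra F A →+* K)) (2 ^ (k / 2)) := by
  have : Finite F := Nat.finite_of_card_ne_zero (by simp [hF])
  have := Fintype.ofFinite F
  have : Finite K := finite_of_surjective hF hφ
  have : CharP K 2 := charP_of_injective_algebraMap (algebraMap F K).injective 2
  have hkk : k / 2 + k / 2 = k := by rw [← mul_two, Nat.div_two_mul_two_of_even hk2]
  -- On `F` both `σ` and the Frobenius power are `c ↦ c ^ 2 ^ (k / 2)`, an involution, so that their
  -- composition fixes `F`.
  let ψ : K →ₐ[F] K :=
    { (iterateFrobenius K 2 (k / 2)).comp σ with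
      commutes' := fun a ↦ by
        change (iterateFrobenius K 2 (k / 2)) (σ (algebraMap F K a)) = _
        rw [← φ.commutes, hσ, AddMonoidAlgebra.coe_algebraMap, Function.comp_apply,
          Algebra.algebraMap_self, RingHom.id_apply, conjHom_single, neg_zero,
          iterateFrobenius_def, iterateFrobenius_def, ← map_pow, single_pow, nsmul_zero, ← pow_mul,
          ← pow_add, hkk, ← mul_one k, pow_two_pow_mul hF] }
  obtain ⟨i, hi⟩ := (FiniteField.bijective_frobeniusAlgHom_pow F K).2 ψ
  set d := charOrder (φ : AddMonoidAlgebra F A →+* K) with hd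
  have hodd : Odd d := charOrder_odd hA _
  have hr : 0 < ordMod d (2 ^ k) :=
    ordMod_pos hodd.pos (Nat.Coprime.pow_left _ (Nat.coprime_two_left.2 hodd))
  -- `ψ` is the `2 ^ (k * i)`-th power, so `d` divides `2 ^ (k * i) + 2 ^ (k / 2)`. To cancel
  -- `2 ^ (k / 2)` also when `i = 0`, a full period of the Frobenius is added to `i`.
  obtain ⟨N, hN⟩ : ∃ N, ordMod d (2 ^ k) + i = N + 1 := ⟨ordMod d (2 ^ k) + i - 1, by omega⟩
  refine ⟨2 * N + 1, ⟨N, rfl⟩, ?_⟩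
  have key : d ∣ 2 ^ (k / 2) * ((2 ^ (k / 2)) ^ (2 * N + 1) + 1) := by
    have : 2 ^ (k / 2) * ((2 ^ (k / 2)) ^ (2 * N + 1) + 1) =
        2 ^ (k * ordMod d (2 ^ k)) * (2 ^ k) ^ (i : ℕ) + 2 ^ (k / 2) := by
      rw [mul_add, mul_one, ← pow_succ', ← pow_mul, ← pow_mul, ← pow_add, ← mul_add, hN]
      have : k / 2 * (2 * N + 1 + 1) = (k / 2 + k / 2) * (N + 1) := by ring
      rw [this, hkk]
    rw [this, hd, charOrder_dvd_iff]
    intro a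
    have h1 := map_pow_ordMod hF (φ : AddMonoidAlgebra F A →+* K) (single a 1)
    have h2 := DFunLike.congr_fun hi (φ (single a 1))
    simp only [frobeniusAlgHom_pow_apply, hF] at h2
    have h3 : ψ (φ (single a 1)) = φ (single (-a) 1) ^ 2 ^ (k / 2) := by
      change (iterateFrobenius K 2 (k / 2)) (σ (φ (single a 1))) = _
      rw [hσ, conjHom_single, map_one, iterateFrobenius_def]
    rw [pow_add, pow_mul, h1]
    change φ (single a 1) ^ _ * φ (single a 1) ^ _ = 1
    rw [h2, h3, ← mul_pow, mul_comm]
    have := mul_map_single_neg (φ : AddMonoidAlgebra F A →+* K) a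
    change φ (single a 1) * φ (single (-a) 1) = 1 at this
    rw [this, one_pow]
  exact (Nat.Coprime.pow_right _ (Nat.coprime_two_right.2 hodd)).dvd_of_dvd_mul_left key

/-- If the order of the character is oddly good, the conjugation of the group ring induces on the
residue field, which has `2 ^ m` elements, the map `z ↦ z ^ 2 ^ (m / 2)`. -/
lemma map_conjHom_of_oddlyGood [CharP F 2] (hF : Nat.card F = 2 ^ k) (hk2 : Even k)
    {φ : AddMonoidAlgebra F A →ₐ[F] K} (hφ : Function.Surjective φ)
    (h : OddlyGood (charOrder (φ : AddMonoidAlgebra F A →+* K)) (2 ^ (k / 2)))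
    (x : AddMonoidAlgebra F A) :
    φ (conjHom A (iterateFrobenius F 2 (k / 2)) x) =
      φ x ^ 2 ^ (k * ordMod (charOrder (φ : AddMonoidAlgebra F A →+* K)) (2 ^ k) / 2) := by
  have : CharP K 2 := charP_of_injective_algebraMap (algebraMap F K).injective 2
  obtain ⟨t, ht, hd⟩ := h
  have hK := natCard_eq_of_surjective hF hφ
  refine (map_conjHom_eq_pow hF hk2 (φ : AddMonoidAlgebra F A →+* K) ht hd x).trans ?_
  set d := charOrder (φ : AddMonoidAlgebra F A →+* K)
  set r := ordMod d (2 ^ k) with hr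
  have hQ : (2 ^ k) ^ t = ((2 ^ (k / 2)) ^ t) ^ 2 := by
    rw [← pow_mul, ← pow_mul, ← pow_mul, mul_comm t, ← mul_assoc, Nat.div_two_mul_two_of_even hk2]
  have hrt : r ∣ t := by
    rw [hr, ordMod_dvd_iff (by positivity), hQ]
    refine hd.trans ⟨(2 ^ (k / 2)) ^ t - 1, ?_⟩
    rw [← Nat.sq_sub_sq, one_pow]
  obtain ⟨j, rfl⟩ := hrt
  have hj : Odd j := Nat.Odd.of_mul_right ht
  have hkr : k / 2 * (r * j) = k * r / 2 * j := by
    rw [← mul_assoc, Nat.div_mul_right_comm hk2.two_dvd]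
  rw [hkr]
  exact pow_two_pow_half_mul hK (hk2.mul_right _) _ hj

lemma map_conjHom_eq_zero_iff [CharP F 2] (hF : Nat.card F = 2 ^ k) (hk2 : Even k)
    {φ : AddMonoidAlgebra F A →ₐ[F] K} (hφ : Function.Surjective φ)
    (h : OddlyGood (charOrder (φ : AddMonoidAlgebra F A →+* K)) (2 ^ (k / 2)))
    (x : AddMonoidAlgebra F A) :
    φ (conjHom A (iterateFrobenius F 2 (k / 2)) x) = 0 ↔ φ x = 0 := by
  rw [map_conjHom_of_oddlyGood hF hk2 hφ h, pow_eq_zero_iff (by positivity)]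

end residue

/-! ### The number of maximal ideals with a given order -/

section count

variable {F A : Type*} [Field F] [AddCommGroup A] [Finite A] {k : ℕ}

/-- The characters of `A` with values in an algebraic closure form a group isomorphic to `A`. -/
lemma natCard_algHom_charOrder (hA : ((AddMonoid.exponent A : ℕ) : F) ≠ 0) (d : ℕ) :
    Nat.card {χ : AddMonoidAlgebra F A →ₐ[F] AlgebraicClosure F //
      charOrder (χ : AddMonoidAlgebra F A →+* AlgebraicClosure F) = d} = numOfOrder A d := by
  have : NeZero ((Monoid.exponent (Multiplicative A) : ℕ) : F) :=
    ⟨by rwa [Monoid.exponent_multiplicative]⟩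
  obtain ⟨e⟩ := CommGroup.monoidHom_mulEquiv_of_hasEnoughRootsOfUnity (Multiplicative A)
    (AlgebraicClosure F)
  let L : (Multiplicative A →* (AlgebraicClosure F)ˣ) → (AddMonoidAlgebra F A →ₐ[F]
      AlgebraicClosure F) := fun χ ↦
    AddMonoidAlgebra.lift F _ _ ((Units.coeHom _).comp χ)
  have hL (χ a) : L χ (single a 1) = (χ (.ofAdd a) : AlgebraicClosure F) := by simp [L]
  have hbij : Function.Bijective L := by
    constructor
    · intro χ ψ h
      refine MonoidHom.ext fun a ↦ Units.ext ?_
      exact (hL χ a.toAdd).symm.trans ((DFunLike.congr_fun h _).trans (hL ψ a.toAdd))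
    · intro χ
      exact ⟨((AddMonoidAlgebra.lift F _ _).symm χ).toHomUnits,
        (AddMonoidAlgebra.lift F _ _).apply_symm_apply χ⟩
  have hord (χ) : charOrder (L χ : AddMonoidAlgebra F A →+* AlgebraicClosure F) = orderOf χ := by
    refine Nat.dvd_right_iff_eq.1 fun n ↦ ?_
    rw [charOrder_dvd_iff, orderOf_dvd_iff_pow_eq_one, MonoidHom.ext_iff]
    refine (Multiplicative.ofAdd.forall_congr_left.trans
      (forall_congr' fun a ↦ ?_))
    rw [← Units.val_inj]
    change L χ _ ^ n = 1 ↔ _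
    rw [hL]
    simp
  rw [numOfOrder]
  refine Nat.card_congr ((Equiv.subtypeEquiv (Multiplicative.ofAdd.trans (e.symm.toEquiv.trans
    (Equiv.ofBijective L hbij))) fun a ↦ ?_).symm)
  change addOrderOf a = d ↔
    charOrder (L (e.symm (.ofAdd a)) : AddMonoidAlgebra F A →+* AlgebraicClosure F) = d
  rw [hord, MulEquiv.orderOf_eq, orderOf_ofAdd_eq_addOrderOf]

/-- Homomorphisms into the algebraic closure, sorted by their kernels. -/
lemma card_maximal_mul_ordMod (hF : Nat.card F = 2 ^ k) (hA : Odd (Nat.card A))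
    (d : ℕ) :
    Nat.card {m : MaximalSpectrum (AddMonoidAlgebra F A) //
      charOrder (Ideal.Quotient.mk m.asIdeal) = d} * ordMod d (2 ^ k) = numOfOrder A d := by
  have : Finite F := Nat.finite_of_card_ne_zero (by simp [hF])
  have := Fintype.ofFinite F
  have : CharP F 2 := charP_of_card_eq_prime_pow (Nat.card_eq_fintype_card.symm.trans hF)
  have : Finite (AddMonoidAlgebra F A) := Module.finite_of_finite F
  have : Finite (MaximalSpectrum (AddMonoidAlgebra F A)) := inferInstance
  let X := {m : MaximalSpectrum (AddMonoidAlgebra F A) //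
      charOrder (Ideal.Quotient.mk m.asIdeal) = d}
  have : Fintype X := Fintype.ofFinite X
  let g (p : Σ m : X, (AddMonoidAlgebra F A ⧸ m.1.asIdeal) →ₐ[F] AlgebraicClosure F) :
      AddMonoidAlgebra F A →ₐ[F] AlgebraicClosure F :=
    p.2.comp (Ideal.Quotient.mkₐ F _)
  have hg_ker (p) : RingHom.ker (g p) = p.1.1.asIdeal := by
    refine (p.1.1.isMaximal.eq_of_le (RingHom.ker_ne_top _) fun x hx ↦ ?_).symm
    change p.2 (Ideal.Quotient.mk _ x) = 0
    rw [Ideal.Quotient.eq_zero_iff_mem.2 hx, map_zero]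
  have hg (p) : charOrder (g p : AddMonoidAlgebra F A →+* AlgebraicClosure F) = d := by
    rw [← p.1.2]
    exact charOrder_eq_of_ker_eq ((hg_ker p).trans Ideal.mk_ker.symm)
  have hbij : Function.Bijective (fun p ↦ (⟨g p, hg p⟩ :
      {χ : AddMonoidAlgebra F A →ₐ[F] AlgebraicClosure F //
        charOrder (χ : AddMonoidAlgebra F A →+* AlgebraicClosure F) = d})) := by
    constructor
    · intro p p' h
      have h : g p = g p' := congrArg Subtype.val h
      have hm : p.1 = p'.1 :=
        Subtype.ext (MaximalSpectrum.ext (by rw [← hg_ker, h, hg_ker]))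
      obtain ⟨m, f⟩ := p
      obtain ⟨m', f'⟩ := p'
      obtain rfl : m = m' := hm
      exact congrArg (Sigma.mk m) (Ideal.Quotient.algHom_ext _ h)
    · rintro ⟨χ, hχ⟩
      have : (RingHom.ker χ).IsPrime := RingHom.ker_isPrime χ
      let m : MaximalSpectrum (AddMonoidAlgebra F A) :=
        ⟨RingHom.ker χ, Ideal.IsPrime.isMaximal' this⟩
      have hm : charOrder (Ideal.Quotient.mk m.asIdeal) = d := by
        rw [← hχ]
        exact charOrder_eq_of_ker_eq Ideal.mk_ker
      refine ⟨⟨⟨m, hm⟩, Ideal.kerLiftAlg χ⟩, Subtype.ext (AlgHom.ext fun x ↦ ?_)⟩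
      exact Ideal.kerLiftAlg_mk χ x
  have hcard (m : X) :
      Nat.card ((AddMonoidAlgebra F A ⧸ m.1.asIdeal) →ₐ[F] AlgebraicClosure F) =
        ordMod d (2 ^ k) := by
    let := Ideal.Quotient.field m.1.asIdeal
    have hs := Ideal.Quotient.mkₐ_surjective F m.1.asIdeal
    have := finite_of_surjective hF hs
    rw [AlgHom.natCard_of_splits _ _ _ fun _ ↦ IsAlgClosed.splits _, finrank_eq_ordMod hF hs]
    exact congrArg (ordMod · (2 ^ k)) m.2
  have hexp : ((AddMonoid.exponent A : ℕ) : F) ≠ 0 := by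
    rw [Ne, CharP.cast_eq_zero_iff F 2, ← even_iff_two_dvd, Nat.not_even_iff_odd]
    exact hA.of_dvd_nat AddGroup.exponent_dvd_nat_card
  rw [← natCard_algHom_charOrder hexp, ← Nat.card_congr (Equiv.ofBijective _ hbij),
    Nat.card_sigma, Finset.sum_congr rfl fun m _ ↦ hcard m]
  simp [X]

end count

/-! ### The involution on the maximal ideals -/

/-- The action of an involution `σ` of a ring on its maximal ideals, by preimages. -/
def maximalComap {B : Type*} [CommRing B] (σ : B →+* B) (hσ : ∀ x, σ (σ x) = x)
    (m : MaximalSpectrum B) : MaximalSpectrum B :=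
  ⟨m.asIdeal.comap σ, Ideal.comap_isMaximal_of_surjective σ fun x ↦ ⟨σ x, hσ x⟩⟩

lemma maximalComap_maximalComap {B : Type*} [CommRing B] (σ : B →+* B) (hσ : ∀ x, σ (σ x) = x)
    (m : MaximalSpectrum B) : maximalComap σ hσ (maximalComap σ hσ m) = m := by
  ext x
  simp [maximalComap, hσ]

/-- The map between residue rings induced by an involution `σ`. The relation between `i` and `j` is
a hypothesis, so that no transport along `τ (τ i) = i` is needed to compose such maps. -/
def residueMap {B : Type*} [CommRing B] (σ : B →+* B) (hσ : ∀ x, σ (σ x) = x)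
    (i j : MaximalSpectrum B) (h : maximalComap σ hσ i = j) :
    B ⧸ j.asIdeal →+* B ⧸ i.asIdeal :=
  Ideal.quotientMap i.asIdeal σ (congrArg MaximalSpectrum.asIdeal h).ge

lemma residueMap_mk {B : Type*} [CommRing B] (σ : B →+* B) (hσ : ∀ x, σ (σ x) = x)
    (i j : MaximalSpectrum B) (h : maximalComap σ hσ i = j) (x : B) :
    residueMap σ hσ i j h (Ideal.Quotient.mk _ x) = Ideal.Quotient.mk _ (σ x) := rfl

lemma residueMap_residueMap {B : Type*} [CommRing B] (σ : B →+* B) (hσ : ∀ x, σ (σ x) = x)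
    (i j : MaximalSpectrum B) (hij : maximalComap σ hσ i = j) (hji : maximalComap σ hσ j = i)
    (x : B ⧸ i.asIdeal) :
    residueMap σ hσ i j hij (residueMap σ hσ j i hji x) = x := by
  obtain ⟨x, rfl⟩ := Ideal.Quotient.mk_surjective x
  rw [residueMap_mk, residueMap_mk, hσ]

/-- Over a reduced Artinian ring with an involution, the self-dual ideals of a group ring are
counted by the residue fields: the fixed maximal ideals contribute self-dual ideals, the pairs of
conjugate maximal ideals contribute arbitrary ideals. -/
lemma card_selfDualIdeals_groupRing {B H : Type*} [CommRing B] [IsArtinianRing B] [IsReduced B]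
    [AddCommGroup H] [Finite H] [Fintype (MaximalSpectrum B)] [LinearOrder (MaximalSpectrum B)]
    (σ : B →+* B) (hσ : ∀ x, σ (σ x) = x) (a b : MaximalSpectrum B → ℕ)
    (ha : ∀ m (hm : maximalComap σ hσ m = m),
      Nat.card (selfDualIdeals (conjHom H (residueMap σ hσ m m hm))) = a m)
    (hb : ∀ m : MaximalSpectrum B, maximalComap σ hσ m ≠ m →
      Nat.card (Ideal (AddMonoidAlgebra (B ⧸ m.asIdeal) H)) = b m) :
    Nat.card (selfDualIdeals (conjHom H σ)) =
      (∏ m with maximalComap σ hσ m = m, a m) * ∏ m with m < maximalComap σ hσ m, b m := by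
  rw [card_selfDualIdeals_pi (groupRingPiEquiv (IsArtinianRing.equivPi B).toRingEquiv)
    (conjHom H σ) (maximalComap σ hσ) (fun i j h ↦ conjHom H (residueMap σ hσ i j h))
    fun x i ↦ groupRingPiEquiv_conjHom _ (fun _ ↦ rfl) x]
  refine card_compatible_families (maximalComap_maximalComap σ hσ)
    (fun i j h ↦ dualIdeal (conjHom H (residueMap σ hσ i j h))) (fun i j hij hji C ↦ ?_) a b ha hb
  let := Ideal.Quotient.field i.asIdeal
  let := Ideal.Quotient.field j.asIdeal
  exact dualIdeal_dualIdeal (residueMap_residueMap σ hσ j i hji hij)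
    (residueMap_residueMap σ hσ i j hij hji) C

/-- A fixed-point-free involution moves exactly half of the elements upwards. -/
lemma card_eq_two_mul_card_filter_lt {ι : Type*} [LinearOrder ι] {τ : ι → ι}
    (hτ : ∀ i, τ (τ i) = i) (s : Finset ι) (hs : ∀ i ∈ s, τ i ∈ s) (hne : ∀ i ∈ s, τ i ≠ i) :
    s.card = 2 * (s.filter fun i ↦ i < τ i).card := by
  have h : (s.filter fun i ↦ ¬ i < τ i).card = (s.filter fun i ↦ i < τ i).card := by
    refine Finset.card_bij' (fun i _ ↦ τ i) (fun i _ ↦ τ i) ?_ ?_ (fun i _ ↦ hτ i) fun i _ ↦ hτ i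
    · intro i hi
      simp only [Finset.mem_filter, hτ] at hi ⊢
      exact ⟨hs i hi.1, lt_of_le_of_ne (not_lt.1 hi.2) (hne i hi.1)⟩
    · intro i hi
      simp only [Finset.mem_filter, hτ] at hi ⊢
      exact ⟨hs i hi.1, hi.2.not_gt⟩
  rw [← Finset.card_filter_add_card_filter_not (s := s) (fun i ↦ i < τ i), h, two_mul]

section groupAlgebra

variable {F A : Type*} [Field F] [CharP F 2] [AddCommGroup A] [Finite A] {k : ℕ}

omit [Finite A] in
/-- A power of Frobenius fixes every element, so no nonzero element is nilpotent. -/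
lemma isReduced_groupAlgebra (hk : 0 < k) (hF : Nat.card F = 2 ^ k) (hA : Odd (Nat.card A)) :
    IsReduced (AddMonoidAlgebra F A) := by
  have : CharP (AddMonoidAlgebra F A) 2 :=
    charP_of_injective_algebraMap (algebraMap F (AddMonoidAlgebra F A)).injective 2
  have hodd := charOrder_odd hA (RingHom.id (AddMonoidAlgebra F A))
  have hr := ordMod_pos hodd.pos (Nat.Coprime.pow_left k (Nat.coprime_two_left.2 hodd))
  rw [isReduced_iff_pow_one_lt _ (Nat.one_lt_two_pow (Nat.mul_pos hk hr).ne')]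
  intro x hx
  rw [← hx]
  exact (map_pow_ordMod hF (RingHom.id _) x).symm

variable (F A k) in
/-- The conjugation of the group algebra of `A` over the field `F` with `2 ^ k` elements, which
is `c ↦ c ^ 2 ^ (k / 2)` on the coefficients. -/
noncomputable abbrev groupAlgebraConj : AddMonoidAlgebra F A →+* AddMonoidAlgebra F A :=
  conjHom A (iterateFrobenius F 2 (k / 2))

omit [CharP F 2] [Finite A] in
lemma charOrder_maximalComap (σ : AddMonoidAlgebra F A →+* AddMonoidAlgebra F A)
    (hσ : ∀ x, σ (σ x) = x) (hσ' : ∀ a, σ (single a 1) = single (-a) 1)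
    (m : MaximalSpectrum (AddMonoidAlgebra F A)) :
    charOrder (Ideal.Quotient.mk (maximalComap σ hσ m).asIdeal) =
      charOrder (Ideal.Quotient.mk m.asIdeal) := by
  refine (charOrder_eq_of_ker_eq (ψ := (Ideal.Quotient.mk m.asIdeal).comp σ) ?_).trans
    (charOrder_eq_of_forall fun n ↦ ?_)
  · rw [Ideal.mk_ker, ← RingHom.comap_ker, Ideal.mk_ker]
    rfl
  · simp only [RingHom.comp_apply, hσ']
    exact ⟨fun h a ↦ neg_neg a ▸ h (-a), fun h a ↦ h (-a)⟩

/-- A maximal ideal is its own conjugate if and only if the order of its character is oddly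
good. -/
lemma maximalComap_eq_self_iff (hF : Nat.card F = 2 ^ k) (hk2 : Even k)
    (hA : Odd (Nat.card A)) (m : MaximalSpectrum (AddMonoidAlgebra F A)) :
    maximalComap (groupAlgebraConj F A k) (conjHom_iterateFrobenius_involutive hF hk2) m = m ↔
      OddlyGood (charOrder (Ideal.Quotient.mk m.asIdeal)) (2 ^ (k / 2)) := by
  let := Ideal.Quotient.field m.asIdeal
  have hs := Ideal.Quotient.mkₐ_surjective F m.asIdeal
  refine ⟨fun h ↦ ?_, fun h ↦ ?_⟩
  · exact oddlyGood_of_conj hF hk2 hA hs (σ := residueMap _ _ m m h) fun x ↦ rfl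
  · ext x
    rw [maximalComap, Ideal.mem_comap, ← Ideal.Quotient.eq_zero_iff_mem,
      ← Ideal.Quotient.eq_zero_iff_mem]
    exact map_conjHom_eq_zero_iff hF hk2 hs h x

/-- The number of Hermitian self-dual codes as a product over the maximal ideals of `F[A]`. -/
lemma card_selfDualIdeals_eq_prod (hk : 0 < k) (hF : Nat.card F = 2 ^ k) (hk2 : Even k)
    (hA : Odd (Nat.card A)) (n : ℕ) [NeZero n] [Fintype (MaximalSpectrum (AddMonoidAlgebra F A))]
    [LinearOrder (MaximalSpectrum (AddMonoidAlgebra F A))]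
    {τ : MaximalSpectrum (AddMonoidAlgebra F A) → MaximalSpectrum (AddMonoidAlgebra F A)}
    (hτ : τ =
      maximalComap (groupAlgebraConj F A k) (conjHom_iterateFrobenius_involutive hF hk2)) :
    Nat.card (selfDualIdeals (conjHom (A × ZMod 2 × ZMod n) (iterateFrobenius F 2 (k / 2)))) =
      (∏ m with τ m = m,
        numHermitianCyclic 2 (k * ordMod (charOrder (Ideal.Quotient.mk m.asIdeal)) (2 ^ k)) n) *
      ∏ m with m < τ m,
        numCyclic 2 (k * ordMod (charOrder (Ideal.Quotient.mk m.asIdeal)) (2 ^ k)) n := by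
  subst hτ
  have : Finite F := Nat.finite_of_card_ne_zero (by simp [hF])
  have : Finite (AddMonoidAlgebra F A) := Module.finite_of_finite F
  have := isReduced_groupAlgebra hk hF hA
  have hpos (m : MaximalSpectrum (AddMonoidAlgebra F A)) :
      k * ordMod (charOrder (Ideal.Quotient.mk m.asIdeal)) (2 ^ k) ≠ 0 := by
    have hodd := charOrder_odd hA (Ideal.Quotient.mk m.asIdeal)
    exact (Nat.mul_pos hk
      (ordMod_pos hodd.pos (Nat.Coprime.pow_left k (Nat.coprime_two_left.2 hodd)))).ne'
  rw [card_selfDualIdeals_congr (curryRight F A _) (curryRight_conjHom _)]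
  refine card_selfDualIdeals_groupRing _ (conjHom_iterateFrobenius_involutive hF hk2) _ _
    (fun m hm ↦ ?_) fun m _ ↦ ?_
  all_goals
    let := Ideal.Quotient.field m.asIdeal
    have hK := natCard_eq_of_surjective hF (Ideal.Quotient.mkₐ_surjective F m.asIdeal)
  · refine numHermitianCyclic_eq (hpos m) hK n fun y ↦ ?_
    obtain ⟨x, rfl⟩ := Ideal.Quotient.mk_surjective y
    exact map_conjHom_of_oddlyGood hF hk2 (Ideal.Quotient.mkₐ_surjective F m.asIdeal)
      ((maximalComap_eq_self_iff hF hk2 hA m).1 hm) x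
  · exact numCyclic_eq (hpos m) hK n

end groupAlgebra

end AbelianCode

theorem theorem2p5 (k s : ℕ) (hk : 0 < k) (hk2 : Even k) (hs : 0 < s)
    {F : Type*} [Field F] (hF : Nat.card F = 2 ^ k)
    {A : Type*} [AddCommGroup A] [Fintype A] (hA : Odd (Nat.card A))
    (M : ℕ) (hM : AddMonoid.exponent A = M) :
    (∀ d ∈ M.divisors,
      AbelianCode.ordMod d (2 ^ k) ∣
          (1 - AbelianCode.lam d (2 ^ (k / 2))) * AbelianCode.numOfOrder A d ∧
        2 * AbelianCode.ordMod d (2 ^ k) ∣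
          AbelianCode.lam d (2 ^ (k / 2)) * AbelianCode.numOfOrder A d) ∧
    Nat.card (AbelianCode.selfDualCodes (G := A × ZMod 2 × ZMod (2 ^ s))
        (AbelianCode.fieldConj (K := F) (2 ^ (k / 2)))) =
      (∏ d ∈ M.divisors,
        AbelianCode.numHermitianCyclic 2 (k * AbelianCode.ordMod d (2 ^ k)) (2 ^ s) ^
          ((1 - AbelianCode.lam d (2 ^ (k / 2))) * AbelianCode.numOfOrder A d /
            AbelianCode.ordMod d (2 ^ k))) *
      ∏ d ∈ M.divisors,
        AbelianCode.numCyclic 2 (k * AbelianCode.ordMod d (2 ^ k)) (2 ^ s) ^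
          (AbelianCode.lam d (2 ^ (k / 2)) * AbelianCode.numOfOrder A d /
            (2 * AbelianCode.ordMod d (2 ^ k))) := by
  classical
  have : Finite F := Nat.finite_of_card_ne_zero (by simp [hF])
  have := Fintype.ofFinite F
  have : CharP F 2 := charP_of_card_eq_prime_pow (Nat.card_eq_fintype_card.symm.trans hF)
  have : Finite (AddMonoidAlgebra F A) := Module.finite_of_finite F
  let := Fintype.ofFinite (MaximalSpectrum (AddMonoidAlgebra F A))
  -- An arbitrary linear order, used to choose one member of each conjugate pair.
  let : LinearOrder (MaximalSpectrum (AddMonoidAlgebra F A)) :=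
    LinearOrder.lift' (Finite.equivFin _) (Finite.equivFin _).injective
  have hinv := AbelianCode.conjHom_iterateFrobenius_involutive (A := A) hF hk2
  obtain ⟨τ, hτ⟩ : ∃ τ, τ = AbelianCode.maximalComap (AbelianCode.groupAlgebraConj F A k) hinv :=
    ⟨_, rfl⟩
  have hττ (m) : τ (τ m) = m := by
    rw [hτ]
    exact AbelianCode.maximalComap_maximalComap _ hinv m
  let ℓ (m : MaximalSpectrum (AddMonoidAlgebra F A)) : ℕ :=
    AbelianCode.charOrder (Ideal.Quotient.mk m.asIdeal)
  have hℓ (m) : ℓ (τ m) = ℓ m := by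
    rw [hτ]
    exact AbelianCode.charOrder_maximalComap _ hinv (fun a ↦ by simp) m
  have hfix (m) : τ m = m ↔ AbelianCode.OddlyGood (ℓ m) (2 ^ (k / 2)) := by
    rw [hτ]
    exact AbelianCode.maximalComap_eq_self_iff hF hk2 hA m
  have hℓM (m) : ℓ m ∈ M.divisors :=
    Nat.mem_divisors.2 ⟨hM ▸ AbelianCode.charOrder_dvd_exponent _,
      hM ▸ AddMonoid.exponent_ne_zero_of_finite⟩
  have hcount (d) : (Finset.univ.filter fun m ↦ ℓ m = d).card * AbelianCode.ordMod d (2 ^ k) =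
      AbelianCode.numOfOrder A d := by
    rw [← AbelianCode.card_maximal_mul_ordMod hF hA d, Nat.card_eq_fintype_card,
      Fintype.card_subtype]
  -- The first exponent counts the fixed maximal ideals with character of order `d`.
  have hfixed (d) : (1 - AbelianCode.lam d (2 ^ (k / 2))) * AbelianCode.numOfOrder A d =
      AbelianCode.ordMod d (2 ^ k) *
        (Finset.univ.filter fun m ↦ τ m = m ∧ ℓ m = d).card := by
    by_cases hd : AbelianCode.OddlyGood d (2 ^ (k / 2))
    · rw [AbelianCode.lam, if_pos hd, Nat.sub_zero, one_mul, ← hcount, mul_comm]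
      congr 2
      ext m
      simp only [Finset.mem_filter, Finset.mem_univ, true_and, hfix]
      exact ⟨fun h ↦ ⟨h ▸ hd, h⟩, And.right⟩
    · rw [AbelianCode.lam, if_neg hd, Nat.sub_self, zero_mul, eq_comm, mul_eq_zero,
        Finset.card_eq_zero, Finset.filter_eq_empty_iff]
      exact .inr fun m _ h ↦ hd (h.2 ▸ (hfix m).1 h.1)
  -- The second exponent counts the conjugate pairs of them, each by its smaller member.
  have hpairs (d) : AbelianCode.lam d (2 ^ (k / 2)) * AbelianCode.numOfOrder A d =
      2 * AbelianCode.ordMod d (2 ^ k) *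
        (Finset.univ.filter fun m ↦ m < τ m ∧ ℓ m = d).card := by
    by_cases hd : AbelianCode.OddlyGood d (2 ^ (k / 2))
    · rw [AbelianCode.lam, if_pos hd, zero_mul, eq_comm, mul_eq_zero,
        Finset.card_eq_zero, Finset.filter_eq_empty_iff]
      exact .inr fun m _ h ↦ h.1.ne' ((hfix m).2 (h.2 ▸ hd))
    · rw [AbelianCode.lam, if_neg hd, one_mul, ← hcount,
        AbelianCode.card_eq_two_mul_card_filter_lt hττ (Finset.univ.filter fun m ↦ ℓ m = d)
          (fun m hm ↦ by simpa [hℓ] using hm)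
          (fun m hm h ↦ hd ((Finset.mem_filter.1 hm).2 ▸ (hfix m).1 h)),
        Finset.filter_filter]
      simp only [and_comm]
      ring
  have hr (d) (hd : d ∈ M.divisors) : 0 < AbelianCode.ordMod d (2 ^ k) := by
    have hodd : Odd d := hA.of_dvd_nat
      ((Nat.dvd_of_mem_divisors hd).trans (hM ▸ AddGroup.exponent_dvd_nat_card))
    exact AbelianCode.ordMod_pos hodd.pos (Nat.Coprime.pow_left k (Nat.coprime_two_left.2 hodd))
  refine ⟨fun d _ ↦ ⟨⟨_, hfixed d⟩, ⟨_, hpairs d⟩⟩, ?_⟩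
  have hconj : AbelianCode.fieldConj (K := F) (2 ^ (k / 2)) = iterateFrobenius F 2 (k / 2) := by
    funext a
    rw [AbelianCode.fieldConj, iterateFrobenius_def]
  rw [hconj, AbelianCode.selfDualCodes_eq,
    AbelianCode.card_selfDualIdeals_eq_prod hk hF hk2 hA (2 ^ s) hτ]
  congr 1
  · rw [← Finset.prod_fiberwise_of_maps_to (t := M.divisors) (g := ℓ) fun m _ ↦ hℓM m]
    refine Finset.prod_congr rfl fun d hd ↦ ?_
    rw [Finset.filter_filter, hfixed, Nat.mul_div_cancel_left _ (hr d hd)]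
    exact Finset.prod_eq_pow_card fun m hm ↦ by rw [← (Finset.mem_filter.1 hm).2.2]
  · rw [← Finset.prod_fiberwise_of_maps_to (t := M.divisors) (g := ℓ) fun m _ ↦ hℓM m]
    refine Finset.prod_congr rfl fun d hd ↦ ?_
    rw [Finset.filter_filter, hpairs,
      Nat.mul_div_cancel_left _ (Nat.mul_pos two_pos (hr d hd))]
    exact Finset.prod_eq_pow_card fun m hm ↦ by rw [← (Finset.mem_filter.1 hm).2.2]
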